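/- Let $S$ be a measurable space, $P$ a Markov transition kernel on $S$, $g,G:S\to\mathbb{R}$ bounded measurable functions (continuation and stopping gains) and $\gamma\in(0,1)$. Optimal stopping. Let $(S_t)_{t\ge 0}$ be a time-homogeneous Markov process with transition kernel $P$, defined on a measurable space $\Omega$ with probability measures $(\mathbb{P}_s)_{s\in S}$ under which $S_0$ has law $\delta_s$, and let $\mathcal{F}_t=\sigma(S_0,\dots,S_t)$. For an $(\mathcal{F}_t)$-stopping time $\tau:\Omega\to\{0,1,\dots,\infty\}$ put $$V^\tau(s)=\mathbb{E}_s\Big[\sum_{t=0}^{\tau-1}\gamma^t g(S_t)+\gamma^\tau G(S_\tau)\Big],$$ where the last term is $0$ on $\{\tau=\infty\}$. Let $V^\star(s)=\sup_\tau V^\tau(s)$, $D^\star=\{s: G(s)\ge V^\star(s)\}$, $C^\star=\{s: G(s)<V^\star(s)\}$ and $\tau^\star=\inf\{t\ge 0: S_t\in D^\star\}$. Stopped MDP. Let $S_\Delta=S\cup\{\Delta\}$ with an additional cemetery state $\Delta$, and let the actions be $0$ (stop) and $1$ (continue), both admissible in every state of $S$. Given state $s$ and action $a$, the next state has law $P(s,\cdot)$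 if $s\in S$ and $a=1$, and is $\Delta$ otherwise. Set $g(\Delta)=G(\Delta)=0$ and $r(s,a)=g(s)a+G(s)(1-a)$ for $s\in S_\Delta$. Let $\Pi$ be the set of stationary (possibly randomized) Markov policies $\pi$ with $\pi(\cdot\mid\Delta)=\delta_0$, and for $\pi\in\Pi$ let $V^\pi(s)=\mathbb{E}^\pi_s\big[\sum_{t\ge 0}\gamma^t r(S^\dagger_t,A_t)\big]$, where $(S^\dagger_t,A_t)_{t\ge0}$ is the state-action process under $\pi$ with $S^\dagger_0=s$. Then: 1. $\tau^\star$ is a stopping time, and it is optimal: $V^{\tau^\star}(s)=\sup_\tau V^\tau(s)$ for every $s\in S$. 2. The deterministic policy $\pi^\star$ with $\pi^\star(\cdot\mid s)=\delta_1$ for $s\in C^\star$ and $\pi^\star(\cdot\mid s)=\delta_0$ for $s\in D^\star\cup\{\Delta\}$ belongs to $\Pi$, and it is optimal: $V^{\pi^\star}(s)=\sup_{\pi\in\Pi}V^\pi(s)$ for every $s\in S_\Delta$. 3. $V^{\tau^\star}(s)=V^{\pi^\star}(s)$ for every $s\in S$. -/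

import Mathlib

open MeasureTheory ProbabilityTheory

/-- The data of a discounted optimal stopping problem on a measurable state space `S`: the
transition kernel of a time-homogeneous Markov process, bounded measurable continuation and
stopping gains, and a discount factor in `(0, 1)`. -/
structure StoppingProblem (S : Type*) [MeasurableSpace S] where
  /-- transition kernel `P(s, dy)` of the state process -/
  P : Kernel S S
  isMarkovKernel : IsMarkovKernel P
  /-- continuation gain -/
  g : S → ℝ
  /-- stopping gain -/
  G : S → ℝ
  /-- discount factor -/
  γ : ℝ
  measurable_g : Measurable g
  measurable_G : Measurable G
  bounded_g : ∃ C, ∀ s, |g s| ≤ C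
  bounded_G : ∃ C, ∀ s, |G s| ≤ C
  γ_pos : 0 < γ
  γ_lt_one : γ < 1

/-- The filtration `ℱ n = σ(X 0, …, X n)` generated by the history of a process. -/
def historyFiltration {S Ω : Type*} [MeasurableSpace S] [mΩ : MeasurableSpace Ω]
    (X : ℕ → Ω → S) (hX : ∀ n, Measurable (X n)) : Filtration ℕ mΩ where
  seq n := ⨆ k ≤ n, MeasurableSpace.comap (X k) inferInstance
  mono' _ _ hij := biSup_mono fun _ hk => le_trans hk hij
  le' _ := iSup₂_le fun k _ => (hX k).comap_le

/-- A time-homogeneous Markov process on `Ω` with transition kernel `P`: a process `X` together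
with probability measures `Pr s`, under which `X` starts from `s` and has the Markov property with
respect to its history. In particular `Pr s (X 1 ∈ B) = P s B`. -/
structure MarkovFamily {S : Type*} [MeasurableSpace S] (P : Kernel S S)
    (Ω : Type*) [MeasurableSpace Ω] where
  X : ℕ → Ω → S
  measurable_X : ∀ n, Measurable (X n)
  Pr : S → Measure Ω
  isProbabilityMeasure : ∀ s, IsProbabilityMeasure (Pr s)
  start : ∀ s, (Pr s).map (X 0) = Measure.dirac s
  markov : ∀ (s : S) (n : ℕ) (B : Set S), MeasurableSet B →
    (Pr s)[(X (n + 1) ⁻¹' B).indicator (fun _ => (1 : ℝ)) | historyFiltration X measurable_X n]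
      =ᵐ[Pr s] fun ω => (P (X n ω)).real B

namespace MarkovFamily

variable {S : Type*} [MeasurableSpace S] {P : Kernel S S} {Ω : Type*} [MeasurableSpace Ω]

/-- The filtration generated by the observed states. -/
def filtration (M : MarkovFamily P Ω) : Filtration ℕ (inferInstance : MeasurableSpace Ω) :=
  historyFiltration M.X M.measurable_X

end MarkovFamily

namespace StoppingProblem

variable {S : Type*} [MeasurableSpace S] (p : StoppingProblem S)

/-! ### The optimal stopping side -/

section OptimalStopping

variable {Ω : Type*} [MeasurableSpace Ω] (M : MarkovFamily p.P Ω)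

open Classical in
/-- The payoff `∑_{t < τ} γ ^ t g(X t) + γ ^ τ G(X τ)`, where the last term is `0` when `τ = ∞`. -/
noncomputable def payoff (τ : Ω → WithTop ℕ) (ω : Ω) : ℝ :=
  (∑' t : ℕ, if (t : WithTop ℕ) < τ ω then p.γ ^ t * p.g (M.X t ω) else 0) +
    if τ ω = ⊤ then 0 else p.γ ^ (τ ω).untopD 0 * p.G (M.X ((τ ω).untopD 0) ω)

/-- The value `V^τ(s)` of stopping at `τ`. -/
noncomputable def stoppingValue (τ : Ω → WithTop ℕ) (s : S) : ℝ :=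
  ∫ ω, p.payoff M τ ω ∂(M.Pr s)

/-- The set of all values `V^τ(s)`, for `τ` a stopping time of the history of the process. -/
def stoppingValues (s : S) : Set ℝ :=
  {v | ∃ τ : Ω → WithTop ℕ, IsStoppingTime M.filtration τ ∧ v = p.stoppingValue M τ s}

/-- The value function `V*(s) = sup_τ V^τ(s)` of the optimal stopping problem. -/
noncomputable def optimalStoppingValue (s : S) : ℝ := sSup (p.stoppingValues M s)

/-- The optimal stopping region `D* = {G ≥ V*}`. -/
def stoppingRegion : Set S := {s | p.optimalStoppingValue M s ≤ p.G s}

/-- The optimal continuation region `C* = {G < V*}`. -/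
def continuationRegion : Set S := {s | p.G s < p.optimalStoppingValue M s}

/-- The hitting time `τ* = min {t ≥ 0 | X t ∈ D*}` (`⊤` if `D*` is never hit). -/
noncomputable def hittingTime : Ω → WithTop ℕ := hittingAfter M.X (p.stoppingRegion M) 0

end OptimalStopping

/-! ### The stopped Markov decision process

States are `S ⊕ Unit`, with cemetery `Δ = Sum.inr ()`; actions are `Fin 2`, where `0` stops and
`1` continues. -/

/-- The continuation gain, extended by zero to the cemetery. -/
def gΔ : S ⊕ Unit → ℝ := Sum.elim p.g fun _ => 0

/-- The stopping gain, extended by zero to the cemetery. -/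
def GΔ : S ⊕ Unit → ℝ := Sum.elim p.G fun _ => 0

/-- The composite reward `r(s, a) = g(s) a + G(s) (1 - a)`. -/
def reward (x : S ⊕ Unit) (a : Fin 2) : ℝ :=
  p.gΔ x * ((a : ℕ) : ℝ) + p.GΔ x * (1 - ((a : ℕ) : ℝ))

/-- The law of the next state: `P(s, ·)` if `s ∈ S` and the action is to continue, and the Dirac
mass at the cemetery in all other cases. -/
noncomputable def transitionMeasure : (S ⊕ Unit) × Fin 2 → Measure (S ⊕ Unit)
  | (Sum.inl s, 1) => (p.P s).map Sum.inl
  | (Sum.inl _, 0) => Measure.dirac (Sum.inr ())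
  | (Sum.inr _, _) => Measure.dirac (Sum.inr ())

theorem measurable_transitionMeasure : Measurable p.transitionMeasure := by
  refine measurable_from_prod_countable_left fun a => ?_
  refine measurable_fun_sum ?_ measurable_from_top
  fin_cases a
  · exact measurable_const
  · exact (Measure.measurable_map _ measurable_inl).comp p.P.measurable

/-- The dynamics of the stopped Markov decision process. -/
noncomputable def transition : Kernel ((S ⊕ Unit) × Fin 2) (S ⊕ Unit) where
  toFun := p.transitionMeasure
  measurable' := p.measurable_transitionMeasure

instance : IsMarkovKernel p.transition where
  isProbabilityMeasure := by
    have := p.isMarkovKernel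
    rintro ⟨s | u, a⟩
    · fin_cases a
      · exact (inferInstance : IsProbabilityMeasure (Measure.dirac (Sum.inr () : S ⊕ Unit)))
      · exact Measure.isProbabilityMeasure_map measurable_inl.aemeasurable
    · exact (inferInstance : IsProbabilityMeasure (Measure.dirac (Sum.inr () : S ⊕ Unit)))

end StoppingProblem

/-- A stationary Markov policy, possibly randomized, that stops at the cemetery:
`π(· | Δ) = δ₀`. -/
structure StationaryPolicy (S : Type*) [MeasurableSpace S] where
  toKernel : Kernel (S ⊕ Unit) (Fin 2)
  isMarkovKernel : IsMarkovKernel toKernel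
  cemetery : toKernel (Sum.inr ()) = Measure.dirac 0

namespace StoppingProblem

variable {S : Type*} [MeasurableSpace S] (p : StoppingProblem S)

/-- The one-step kernel of the state-action process under `π`: the next state is drawn from the
dynamics, and then the next action from the policy at that state. -/
noncomputable def stepKernel (π : StationaryPolicy S) :
    Kernel ((S ⊕ Unit) × Fin 2) ((S ⊕ Unit) × Fin 2) :=
  p.transition ⊗ₖ Kernel.prodMkLeft ((S ⊕ Unit) × Fin 2) π.toKernel

instance (π : StationaryPolicy S) : IsMarkovKernel (p.stepKernel π) := by
  have := π.isMarkovKernel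
  unfold stepKernel
  infer_instance

/-- The law of the state-action process `(S†_t, A_t)` under the policy `π`, when the initial
state has law `p₀`. -/
noncomputable def processLaw (π : StationaryPolicy S) (p₀ : Measure (S ⊕ Unit))
    [IsProbabilityMeasure p₀] :
    Measure (ℕ → (S ⊕ Unit) × Fin 2) :=
  Kernel.trajMeasure (X := fun _ => (S ⊕ Unit) × Fin 2) (p₀ ⊗ₘ π.toKernel)
    fun n => (p.stepKernel π).comap (fun h => h ⟨n, Finset.mem_Iic.2 le_rfl⟩)
      (measurable_pi_apply _)

/-- The value `V^π(x)` of the policy `π`: the expected total discounted reward from `x`. -/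
noncomputable def policyValue (π : StationaryPolicy S) (x : S ⊕ Unit) : ℝ :=
  ∫ z, ∑' t : ℕ, p.γ ^ t * p.reward (z t).1 (z t).2 ∂(p.processLaw π (Measure.dirac x))

end StoppingProblem

/-! Both problems have the same Bellman equation `W = max(G, g + γ P W)`. Its operator is a
γ-contraction in the sup norm, so iteration from 0 converges to a bounded measurable solution `W`
(`exists_bellman_eq_self`). Everything else is verification: both optimal values are shown to equal
`W` on `S`.

For a stopping time, let `a n` be γ^n times the integral of `W(X n)` over {n ≤ τ}. Since {n < τ}
belongs to the past at time `n`, the Markov property turns the payoff expected at time `n` plus `a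
(n + 1)` into an expression in `X n`, which the Bellman equation bounds by `a n`. Telescoping, with
`a n → 0`, bounds the total payoff by `a 0 = W(s)` (`stoppingValue_le`). Equality holds at each step
when τ is the first entry into {W ≤ G}: before τ the maximum is the continuation branch, and at τ
one has `G = W` (`stoppingValue_eq`). Hence V* = `W`, and D* = {W ≤ G} is measurable.

For the stopped MDP, extend `W` by 0 to the cemetery. The two action values at a state of `S` are
the two branches of the maximum, so the same telescoping, run on the one-time marginals of the
state-action chain, bounds every policy by `W` (`policyValue_le`) and gives equality for the policy
that stops exactly on {W ≤ G} (`policyValue_eq`). -/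

open Filter Topology

attribute [instance] StoppingProblem.isMarkovKernel MarkovFamily.isProbabilityMeasure
  StationaryPolicy.isMarkovKernel

/-! ### Bounded integrands and telescoping of discounted sums -/

/-- A measurable function bounded by a constant is integrable for any finite measure. -/
theorem integrable_of_measurable_of_abs_le {α : Type*} [MeasurableSpace α] {μ : Measure α}
    [IsFiniteMeasure μ] {f : α → ℝ} (hf : Measurable f) {C : ℝ} (hC : ∀ x, |f x| ≤ C) :
    Integrable f μ :=
  Integrable.of_bound hf.aestronglyMeasurable C (ae_of_all _ fun x => hC x)

theorem abs_integral_le_of_abs_le {α : Type*} [MeasurableSpace α] {μ : Measure α}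
    [IsProbabilityMeasure μ] {f : α → ℝ} {C : ℝ} (hC : ∀ x, |f x| ≤ C) :
    |∫ x, f x ∂μ| ≤ C := by
  simpa using norm_integral_le_of_norm_le_const (μ := μ) (f := f) (C := C) (ae_of_all _ hC)

theorem measurable_integral_kernel {α β : Type*} [MeasurableSpace α] [MeasurableSpace β]
    (κ : Kernel α β) [IsSFiniteKernel κ] {f : β → ℝ} (hf : Measurable f) :
    Measurable fun a => ∫ b, f b ∂κ a :=
  (hf.stronglyMeasurable.integral_kernel (κ := κ)).measurable

/-- Verification inequality for discounted rewards: if the expected rewards `F n` are dominated by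
the decrements of a geometrically vanishing sequence `a`, then the expected total reward is at most
`a 0`. -/
theorem integral_tsum_le_of_add_le {α : Type*} [MeasurableSpace α] {μ : Measure α}
    [IsProbabilityMeasure μ] {γ : ℝ} (h0 : 0 < γ) (h1 : γ < 1) {F : ℕ → α → ℝ} {a : ℕ → ℝ}
    {C K : ℝ} (hF : ∀ n, Measurable (F n)) (hC : ∀ n x, |F n x| ≤ γ ^ n * C)
    (ha : ∀ n, |a n| ≤ γ ^ n * K) (h : ∀ n, ∫ x, F n x ∂μ + a (n + 1) ≤ a n) :
    ∫ x, ∑' n, F n x ∂μ ≤ a 0 := by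
  have hgeo := summable_geometric_of_lt_one h0.le h1
  -- The geometric bound on the rewards justifies exchanging sum and integral.
  have hsum : HasSum (fun n => ∫ x, F n x ∂μ) (∫ x, ∑' n, F n x ∂μ) := by
    refine hasSum_integral_of_summable_integral_norm
      (fun n => integrable_of_measurable_of_abs_le (hF n) (hC n))
      (Summable.of_norm_bounded (hgeo.mul_right C) fun n => ?_)
    exact abs_integral_le_of_abs_le fun x => by simpa using hC n x
  have hlim : Tendsto a atTop (𝓝 0) := by
    refine squeeze_zero_norm ha ?_
    simpa using (tendsto_pow_atTop_nhds_zero_of_lt_one h0.le h1).mul_const K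
  have hpart (n : ℕ) : ∑ i ∈ Finset.range n, ∫ x, F i x ∂μ ≤ a 0 - a n := by
    induction n with
    | zero => simp
    | succ n ih => rw [Finset.sum_range_succ]; linarith [h n]
  simpa using le_of_tendsto_of_tendsto' hsum.tendsto_sum_nat (hlim.const_sub (a 0)) hpart

/-- The inequality applies to `F`, `a` and also to their negatives, since all bounds are on absolute
values. -/
theorem integral_tsum_eq_of_add_eq {α : Type*} [MeasurableSpace α] {μ : Measure α}
    [IsProbabilityMeasure μ] {γ : ℝ} (h0 : 0 < γ) (h1 : γ < 1) {F : ℕ → α → ℝ} {a : ℕ → ℝ}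
    {C K : ℝ} (hF : ∀ n, Measurable (F n)) (hC : ∀ n x, |F n x| ≤ γ ^ n * C)
    (ha : ∀ n, |a n| ≤ γ ^ n * K) (h : ∀ n, ∫ x, F n x ∂μ + a (n + 1) = a n) :
    ∫ x, ∑' n, F n x ∂μ = a 0 := by
  refine le_antisymm (integral_tsum_le_of_add_le h0 h1 hF hC ha fun n => (h n).le) ?_
  have := integral_tsum_le_of_add_le (μ := μ) (F := fun n x => -F n x) (a := fun n => -a n) h0 h1
    (fun n => (hF n).neg) (fun n x => by simpa using hC n x) (fun n => by simpa using ha n)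
    (fun n => by rw [integral_neg]; linarith [h n])
  simp only [tsum_neg, integral_neg] at this
  linarith

/-! ### The Bellman operator and its fixed point -/

namespace StoppingProblem

variable {S : Type*} [MeasurableSpace S] (p : StoppingProblem S)

theorem exists_bound : ∃ C, (∀ s, |p.g s| ≤ C) ∧ ∀ s, |p.G s| ≤ C := by
  obtain ⟨C, hC⟩ := p.bounded_g
  obtain ⟨D, hD⟩ := p.bounded_G
  exact ⟨max C D, fun s => (hC s).trans (le_max_left _ _), fun s => (hD s).trans (le_max_right _ _)⟩

/-- The value `g(s) + γ ∫ f dP(s, ·)` of continuing for one step and then collecting `f`. -/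
noncomputable def continuationValue (f : S → ℝ) (s : S) : ℝ := p.g s + p.γ * ∫ y, f y ∂p.P s

/-- The Bellman operator of the optimal stopping problem. -/
noncomputable def bellman (f : S → ℝ) (s : S) : ℝ := max (p.G s) (p.continuationValue f s)

theorem measurable_continuationValue {f : S → ℝ} (hf : Measurable f) :
    Measurable (p.continuationValue f) :=
  p.measurable_g.add ((measurable_integral_kernel p.P hf).const_mul _)

theorem measurable_bellman {f : S → ℝ} (hf : Measurable f) : Measurable (p.bellman f) :=
  p.measurable_G.max (p.measurable_continuationValue hf)

theorem abs_mul_integral_le {α : Type*} [MeasurableSpace α] {μ : Measure α}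
    [IsProbabilityMeasure μ] {f : α → ℝ} {K : ℝ} (hf : ∀ x, |f x| ≤ K) :
    |p.γ * ∫ x, f x ∂μ| ≤ p.γ * K := by
  rw [abs_mul, abs_of_pos p.γ_pos]
  exact mul_le_mul_of_nonneg_left (abs_integral_le_of_abs_le hf) p.γ_pos.le

theorem abs_continuationValue_le {f : S → ℝ} {C K : ℝ} (hg : ∀ s, |p.g s| ≤ C)
    (hf : ∀ s, |f s| ≤ K) (s : S) : |p.continuationValue f s| ≤ C + p.γ * K :=
  (abs_add_le _ _).trans (add_le_add (hg s) (p.abs_mul_integral_le hf))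

theorem abs_bellman_le {f : S → ℝ} {C K : ℝ} (hg : ∀ s, |p.g s| ≤ C) (hG : ∀ s, |p.G s| ≤ C)
    (hf : ∀ s, |f s| ≤ K) (s : S) : |p.bellman f s| ≤ C + p.γ * K := by
  have hm : |p.γ * ∫ y, f y ∂p.P s| ≤ p.γ * K := p.abs_mul_integral_le hf
  refine abs_max_le_max_abs_abs.trans (max_le ?_ (p.abs_continuationValue_le hg hf s))
  -- `K` is not assumed nonnegative; `hm` itself forces `0 ≤ γ K`.
  linarith [hG s, abs_nonneg (p.γ * ∫ y, f y ∂p.P s)]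

/-- Taking the maximum with the common `G` is 1-Lipschitz, and averaging against a probability
measure does not increase the sup distance, so only the discount factor remains. The bounds `K` and
`L` serve integrability alone. -/
theorem abs_bellman_sub_le {f h : S → ℝ} (hf : Measurable f) (hh : Measurable h) {K L D : ℝ}
    (hfK : ∀ s, |f s| ≤ K) (hhL : ∀ s, |h s| ≤ L) (hD : ∀ s, |f s - h s| ≤ D) (s : S) :
    |p.bellman f s - p.bellman h s| ≤ p.γ * D := by
  have hsub : p.continuationValue f s - p.continuationValue h s
      = p.γ * ∫ y, (f y - h y) ∂p.P s := by
    rw [integral_sub (integrable_of_measurable_of_abs_le hf hfK)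
      (integrable_of_measurable_of_abs_le hh hhL)]
    simp only [continuationValue]
    ring
  unfold bellman
  rw [max_comm (p.G s), max_comm (p.G s)]
  refine (abs_max_sub_max_le_abs _ _ _).trans ?_
  rw [hsub]
  exact p.abs_mul_integral_le hD

/-- The Bellman equation has a bounded measurable solution. -/
theorem exists_bellman_eq_self :
    ∃ W : S → ℝ, Measurable W ∧ (∃ K, ∀ s, |W s| ≤ K) ∧ p.bellman W = W := by
  obtain ⟨C, hg, hG⟩ := p.exists_bound
  have h1 : 0 < 1 - p.γ := sub_pos.2 p.γ_lt_one
  -- A point of `S` is needed to know that `C` is nonnegative.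
  rcases isEmpty_or_nonempty S with hS | ⟨⟨s₀⟩⟩
  · exact ⟨0, measurable_zero, ⟨0, fun s => by simp⟩, Subsingleton.elim _ _⟩
  have hC : 0 ≤ C := (abs_nonneg _).trans (hg s₀)
  -- The fixed point of `K ↦ C + γ K`, so the iterates never leave the ball of radius `K`.
  set K := C / (1 - p.γ)
  have hK : 0 ≤ K := div_nonneg hC h1.le
  have hCK : C + p.γ * K = K := by simp only [K]; field_simp; ring
  let w : ℕ → S → ℝ := fun n => p.bellman^[n] 0
  have hw (n : ℕ) : w (n + 1) = p.bellman (w n) := Function.iterate_succ_apply' _ _ _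
  have hmeas (n : ℕ) : Measurable (w n) := by
    induction n with
    | zero => exact measurable_zero
    | succ n ih => rw [hw]; exact p.measurable_bellman ih
  have hbdd (n : ℕ) (s : S) : |w n s| ≤ K := by
    induction n generalizing s with
    | zero => simpa [w] using hK
    | succ n ih => rw [hw]; exact (p.abs_bellman_le hg hG ih s).trans_eq hCK
  have hstep (n : ℕ) (s : S) : |w n s - w (n + 1) s| ≤ K * p.γ ^ n := by
    induction n generalizing s with
    | zero => simpa [w] using hbdd 1 s
    | succ n ih =>
      rw [hw n, hw (n + 1)]
      exact (p.abs_bellman_sub_le (hmeas n) (hmeas (n + 1)) (hbdd n) (hbdd (n + 1)) ih s).trans_eq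
        (by ring)
  have hlim (s : S) : ∃ l, Tendsto (fun n => w n s) atTop (𝓝 l) :=
    cauchySeq_tendsto_of_complete (cauchySeq_of_le_geometric p.γ K p.γ_lt_one fun n => hstep n s)
  choose W hW using hlim
  -- Pointwise limits preserve measurability; dominated convergence then passes the limit through
  -- the kernel, and so through the Bellman operator.
  refine ⟨W, measurable_of_tendsto_metrizable hmeas (tendsto_pi_nhds.2 hW),
    ⟨K, fun s => le_of_tendsto' (hW s).abs fun n => hbdd n s⟩, funext fun s => ?_⟩
  have hint : Tendsto (fun n => ∫ y, w n y ∂p.P s) atTop (𝓝 (∫ y, W y ∂p.P s)) :=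
    tendsto_integral_of_dominated_convergence (fun _ => K)
      (fun n => (hmeas n).aestronglyMeasurable) (integrable_const K)
      (fun n => ae_of_all _ (hbdd n)) (ae_of_all _ hW)
  have hb : Tendsto (fun n => w (n + 1) s) atTop (𝓝 (p.bellman W s)) := by
    simp only [hw]
    exact tendsto_const_nhds.max (tendsto_const_nhds.add (hint.const_mul _))
  exact tendsto_nhds_unique hb ((tendsto_add_atTop_iff_nat 1).2 (hW s))

end StoppingProblem

/-! ### The Markov property on past events -/

/-- Integration against the composition of a kernel and a measure. -/
theorem integral_measure_comp {α β : Type*} [MeasurableSpace α] [MeasurableSpace β]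
    {μ : Measure α} [IsFiniteMeasure μ] {κ : Kernel α β} [IsMarkovKernel κ] {f : β → ℝ}
    (hf : Measurable f) {C : ℝ} (hC : ∀ x, |f x| ≤ C) :
    ∫ y, f y ∂(κ ∘ₘ μ) = ∫ x, ∫ y, f y ∂κ x ∂μ := by
  rw [← Measure.snd_compProd, Measure.snd,
    integral_map measurable_snd.aemeasurable hf.aestronglyMeasurable,
    Measure.integral_compProd (f := fun x => f x.2)
      (integrable_of_measurable_of_abs_le (hf.comp measurable_snd) fun x => hC x.2)]

/-- This aligns the telescoping index: the event attached to time `n + 1` is already decided at time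
`n`, as the Markov property requires. -/
theorem setOf_coe_succ_le {Ω : Type*} (τ : Ω → WithTop ℕ) (n : ℕ) :
    {ω | WithTop.some (n + 1) ≤ τ ω} = {ω | WithTop.some n < τ ω} := by
  ext ω
  cases h : τ ω with
  | top => simp [h]
  | coe k =>
    simp only [Set.mem_ofPred_eq, h, WithTop.coe_le_coe, WithTop.coe_lt_coe, Nat.succ_le_iff]

theorem abs_indicator_le {α : Type*} {A : Set α} {f : α → ℝ} {C : ℝ} (hf : ∀ x, |f x| ≤ C) (x : α) :
    |A.indicator f x| ≤ C :=
  (norm_indicator_le_norm_self f x).trans (hf x)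

namespace MarkovFamily

variable {S : Type*} [MeasurableSpace S] {P : Kernel S S} {Ω : Type*} [MeasurableSpace Ω]
  (M : MarkovFamily P Ω)

theorem adapted : Adapted M.filtration M.X := fun n => by
  refine Measurable.of_comap_le ?_
  exact le_iSup₂_of_le (f := fun k (_ : k ≤ n) => MeasurableSpace.comap (M.X k) inferInstance)
    n le_rfl le_rfl

theorem measurableSet_of_filtration {n : ℕ} {A : Set Ω} (hA : MeasurableSet[M.filtration n] A) :
    MeasurableSet A :=
  M.filtration.le n A hA

/-- The Markov property on an event of the past. -/
theorem map_restrict_succ [IsMarkovKernel P] (s : S) (n : ℕ) {A : Set Ω}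
    (hA : MeasurableSet[M.filtration n] A) :
    ((M.Pr s).restrict A).map (M.X (n + 1)) = P ∘ₘ ((M.Pr s).restrict A).map (M.X n) := by
  ext B hB
  have hBn : MeasurableSet (M.X (n + 1) ⁻¹' B) := M.measurable_X _ hB
  have hreal : ((M.Pr s).restrict A).real (M.X (n + 1) ⁻¹' B)
      = ∫ ω in A, (P (M.X n ω)).real B ∂M.Pr s := by
    rw [← setIntegral_congr_ae (M.measurableSet_of_filtration hA)
        ((M.markov s n B hB).mono fun ω h _ => h),
      setIntegral_condExp ((historyFiltration M.X M.measurable_X).le n)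
        ((integrable_const _).indicator hBn) hA, integral_indicator hBn]
    simp
  rw [Measure.map_apply (M.measurable_X _) hB, Measure.bind_apply hB P.measurable.aemeasurable,
    lintegral_map (P.measurable_coe hB) (M.measurable_X n), ← ofReal_measureReal, hreal]
  simp only [measureReal_def]
  rw [integral_toReal (f := fun ω => P (M.X n ω) B)
      ((P.measurable_coe hB).comp (M.measurable_X n)).aemeasurable
    (ae_of_all _ fun ω => measure_lt_top _ _), ENNReal.ofReal_toReal]
  refine ne_top_of_le_ne_top (measure_ne_top ((M.Pr s).restrict A) Set.univ) ?_
  simpa using lintegral_mono (μ := (M.Pr s).restrict A)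
    fun ω => prob_le_one (μ := P (M.X n ω)) (s := B)

theorem setIntegral_succ [IsMarkovKernel P] (s : S) (n : ℕ) {A : Set Ω}
    (hA : MeasurableSet[M.filtration n] A) {f : S → ℝ} (hf : Measurable f) {C : ℝ}
    (hC : ∀ x, |f x| ≤ C) :
    ∫ ω in A, f (M.X (n + 1) ω) ∂M.Pr s = ∫ ω in A, ∫ y, f y ∂P (M.X n ω) ∂M.Pr s := by
  have : IsFiniteMeasure (((M.Pr s).restrict A).map (M.X n)) := by infer_instance
  rw [← integral_map (M.measurable_X _).aemeasurable hf.aestronglyMeasurable,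
    M.map_restrict_succ s n hA, integral_measure_comp hf hC,
    integral_map (M.measurable_X _).aemeasurable
      (measurable_integral_kernel P hf).aestronglyMeasurable]

theorem integral_start (s : S) {f : S → ℝ} (hf : Measurable f) :
    ∫ ω, f (M.X 0 ω) ∂M.Pr s = f s := by
  rw [← integral_map (M.measurable_X _).aemeasurable hf.aestronglyMeasurable, M.start,
    integral_dirac' _ _ hf.stronglyMeasurable]

end MarkovFamily

/-! ### Verification for stopping times -/

namespace StoppingProblem

variable {S : Type*} [MeasurableSpace S] (p : StoppingProblem S)
  {Ω : Type*} [MeasurableSpace Ω] (M : MarkovFamily p.P Ω)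

/-- The discounted payoff collected at time `n` when stopping at `τ`. -/
noncomputable def payoffAt (τ : Ω → WithTop ℕ) (n : ℕ) (ω : Ω) : ℝ :=
  p.γ ^ n * ({ω | WithTop.some n < τ ω}.indicator (fun ω => p.g (M.X n ω)) ω +
    {ω | τ ω = WithTop.some n}.indicator (fun ω => p.G (M.X n ω)) ω)

theorem summable_pow_mul {f : ℕ → ℝ} {C : ℝ} (hf : ∀ n, |f n| ≤ C) :
    Summable fun n => p.γ ^ n * f n := by
  refine Summable.of_norm_bounded
    ((summable_geometric_of_lt_one p.γ_pos.le p.γ_lt_one).mul_right C) fun n => ?_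
  rw [norm_mul, norm_pow, Real.norm_of_nonneg p.γ_pos.le]
  exact mul_le_mul_of_nonneg_left (hf n) (pow_nonneg p.γ_pos.le n)

/-- At most one term of the stopping series is nonzero, at `n = τ`, and none is when `τ = ⊤`. This
puts the payoff in the form handled by the telescoping lemmas. -/
theorem payoff_eq_tsum (τ : Ω → WithTop ℕ) (ω : Ω) :
    p.payoff M τ ω = ∑' n, p.payoffAt M τ n ω := by
  obtain ⟨C, hg, hG⟩ := p.exists_bound
  unfold payoffAt
  simp only [mul_add]
  rw [Summable.tsum_add
    (p.summable_pow_mul fun n => abs_indicator_le (fun ω => hg _) ω)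
    (p.summable_pow_mul fun n => abs_indicator_le (fun ω => hG _) ω), payoff]
  congr 1
  · refine tsum_congr fun n => ?_
    simp [Set.indicator_apply]
  · split_ifs with h
    · simp [h]
    · obtain ⟨k, hk⟩ := WithTop.ne_top_iff_exists.1 h
      rw [tsum_eq_single k]
      · simp only [← hk, Set.indicator_apply, Set.mem_ofPred_eq, if_true]
        rfl
      · intro n hn
        have : τ ω ≠ n := by rw [← hk]; exact fun h => hn (WithTop.coe_injective h).symm
        simp [this]

variable {p M} {τ : Ω → WithTop ℕ}

theorem measurableSet_lt_of_isStoppingTime (hτ : IsStoppingTime M.filtration τ) (n : ℕ) :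
    MeasurableSet[M.filtration n] {ω | WithTop.some n < τ ω} := by
  convert (hτ n).compl using 1
  ext ω
  simp

theorem measurable_payoffAt (hτ : IsStoppingTime M.filtration τ) (n : ℕ) :
    Measurable (p.payoffAt M τ n) :=
  ((((p.measurable_g.comp (M.measurable_X n)).indicator
      (M.measurableSet_of_filtration (measurableSet_lt_of_isStoppingTime hτ n))).add
    ((p.measurable_G.comp (M.measurable_X n)).indicator
      (M.measurableSet_of_filtration (hτ.measurableSet_eq n))))).const_mul _

theorem abs_payoffAt_le {C : ℝ} (hg : ∀ s, |p.g s| ≤ C) (hG : ∀ s, |p.G s| ≤ C) (n : ℕ) (ω : Ω) :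
    |p.payoffAt M τ n ω| ≤ p.γ ^ n * (C + C) := by
  rw [payoffAt, abs_mul, abs_of_pos (pow_pos p.γ_pos n)]
  refine mul_le_mul_of_nonneg_left ((abs_add_le _ _).trans (add_le_add ?_ ?_))
    (pow_nonneg p.γ_pos.le n)
  exacts [abs_indicator_le (fun ω => hg _) ω, abs_indicator_le (fun ω => hG _) ω]

/-- The event {n < τ} lies in the past at time `n`, so there `W(X (n + 1))` may be replaced by the
average of `W` under the kernel at `X n`; with `g` it forms the continuation value. -/
theorem integral_payoffAt_add (hτ : IsStoppingTime M.filtration τ) {W : S → ℝ} (hW : Measurable W)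
    {K : ℝ} (hK : ∀ s, |W s| ≤ K) (s : S) (n : ℕ) :
    ∫ ω, p.payoffAt M τ n ω ∂M.Pr s
        + p.γ ^ (n + 1) * ∫ ω in {ω | WithTop.some n < τ ω}, W (M.X (n + 1) ω) ∂M.Pr s =
      p.γ ^ n * (∫ ω in {ω | WithTop.some n < τ ω}, p.continuationValue W (M.X n ω) ∂M.Pr s
        + ∫ ω in {ω | τ ω = WithTop.some n}, p.G (M.X n ω) ∂M.Pr s) := by
  obtain ⟨C, hg, hG⟩ := p.exists_bound
  have hA := M.measurableSet_of_filtration (measurableSet_lt_of_isStoppingTime hτ n)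
  have hB := M.measurableSet_of_filtration (hτ.measurableSet_eq n)
  have ig : Integrable (fun ω => p.g (M.X n ω)) (M.Pr s) :=
    integrable_of_measurable_of_abs_le (p.measurable_g.comp (M.measurable_X n)) fun ω => hg _
  have iG : Integrable (fun ω => p.G (M.X n ω)) (M.Pr s) :=
    integrable_of_measurable_of_abs_le (p.measurable_G.comp (M.measurable_X n)) fun ω => hG _
  have iW : Integrable (fun ω => ∫ y, W y ∂p.P (M.X n ω)) (M.Pr s) :=
    integrable_of_measurable_of_abs_le ((measurable_integral_kernel p.P hW).comp (M.measurable_X n))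
      fun ω => abs_integral_le_of_abs_le hK
  simp only [payoffAt, continuationValue]
  rw [integral_const_mul, integral_add (ig.indicator hA) (iG.indicator hB), integral_indicator hA,
    integral_indicator hB, M.setIntegral_succ s n (measurableSet_lt_of_isStoppingTime hτ n) hW hK,
    integral_add ig.integrableOn (iW.const_mul _).integrableOn, integral_const_mul]
  ring

/-- The discounted expected value on the event that `τ` has not occurred before time `n`. -/
theorem setIntegral_le_stoppingTime (hτ : IsStoppingTime M.filtration τ) {W : S → ℝ}
    (hW : Measurable W) {K : ℝ} (hK : ∀ s, |W s| ≤ K) (s : S) (n : ℕ) :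
    ∫ ω in {ω | WithTop.some n ≤ τ ω}, W (M.X n ω) ∂M.Pr s =
      ∫ ω in {ω | WithTop.some n < τ ω}, W (M.X n ω) ∂M.Pr s
        + ∫ ω in {ω | τ ω = WithTop.some n}, W (M.X n ω) ∂M.Pr s := by
  have iW : Integrable (fun ω => W (M.X n ω)) (M.Pr s) :=
    integrable_of_measurable_of_abs_le (hW.comp (M.measurable_X n)) fun ω => hK _
  rw [← setIntegral_union _ (M.measurableSet_of_filtration (hτ.measurableSet_eq n)) iW.integrableOn
    iW.integrableOn]
  · congr 2
    ext ω
    simp [le_iff_lt_or_eq, eq_comm]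
  · rw [Set.disjoint_left]
    exact fun ω h h' => h.ne' h'

theorem abs_pow_mul_setIntegral_le {W : S → ℝ} {K : ℝ} (hK : ∀ s, |W s| ≤ K) (s : S) (n : ℕ)
    (hn : MeasurableSet {ω | WithTop.some n ≤ τ ω}) :
    |p.γ ^ n * ∫ ω in {ω | WithTop.some n ≤ τ ω}, W (M.X n ω) ∂M.Pr s| ≤ p.γ ^ n * K := by
  rw [abs_mul, abs_of_pos (pow_pos p.γ_pos n), ← integral_indicator hn]
  exact mul_le_mul_of_nonneg_left
    (abs_integral_le_of_abs_le (abs_indicator_le fun ω => hK _)) (pow_nonneg p.γ_pos.le n)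

theorem measurableSet_le_of_isStoppingTime (hτ : IsStoppingTime M.filtration τ) (n : ℕ) :
    MeasurableSet {ω | WithTop.some n ≤ τ ω} := by
  convert (M.measurableSet_of_filtration (hτ.measurableSet_lt n)).compl using 1
  ext ω
  simp

/-- A solution of the Bellman equation dominates the value of every stopping time. -/
theorem stoppingValue_le (hτ : IsStoppingTime M.filtration τ) {W : S → ℝ} (hW : Measurable W)
    {K : ℝ} (hK : ∀ s, |W s| ≤ K) (hfix : p.bellman W = W) (s : S) :
    p.stoppingValue M τ s ≤ W s := by
  obtain ⟨C, hg, hG⟩ := p.exists_bound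
  have hle (s : S) : p.continuationValue W s ≤ W s :=
    (le_max_right _ _).trans_eq (congrFun hfix s)
  have hGle (s : S) : p.G s ≤ W s := (le_max_left _ _).trans_eq (congrFun hfix s)
  simp only [stoppingValue, payoff_eq_tsum]
  refine (integral_tsum_le_of_add_le p.γ_pos p.γ_lt_one (measurable_payoffAt hτ)
    (abs_payoffAt_le hg hG) (fun n => abs_pow_mul_setIntegral_le (M := M) (τ := τ) hK s n
      (measurableSet_le_of_isStoppingTime hτ n)) fun n => ?_).trans_eq ?_
  · rw [setOf_coe_succ_le, integral_payoffAt_add hτ hW hK, setIntegral_le_stoppingTime hτ hW hK]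
    have iX {f : S → ℝ} (hf : Measurable f) {D : ℝ} (hD : ∀ s, |f s| ≤ D) (A : Set Ω) :
        IntegrableOn (fun ω => f (M.X n ω)) A (M.Pr s) :=
      integrable_of_measurable_of_abs_le (hf.comp (M.measurable_X n)) fun ω => hD _
    refine mul_le_mul_of_nonneg_left (add_le_add ?_ ?_) (pow_nonneg p.γ_pos.le n)
    · exact setIntegral_mono (iX (p.measurable_continuationValue hW)
        (p.abs_continuationValue_le hg hK) _) (iX hW hK _) fun ω => hle _
    · exact setIntegral_mono (iX p.measurable_G hG _) (iX hW hK _) fun ω => hGle _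
  -- The event {0 ≤ τ} is everything, and `X 0` has law δ_s.
  · simp [M.integral_start s hW]

/-- A stopping time that stops only where stopping is optimal and continues only where continuing
is optimal attains the solution of the Bellman equation. -/
theorem stoppingValue_eq (hτ : IsStoppingTime M.filtration τ) {W : S → ℝ} (hW : Measurable W)
    {K : ℝ} (hK : ∀ s, |W s| ≤ K)
    (hlt : ∀ (n : ℕ) ω, WithTop.some n < τ ω → p.continuationValue W (M.X n ω) = W (M.X n ω))
    (heq : ∀ (n : ℕ) ω, τ ω = WithTop.some n → p.G (M.X n ω) = W (M.X n ω)) (s : S) :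
    p.stoppingValue M τ s = W s := by
  obtain ⟨C, hg, hG⟩ := p.exists_bound
  simp only [stoppingValue, payoff_eq_tsum]
  refine (integral_tsum_eq_of_add_eq p.γ_pos p.γ_lt_one (measurable_payoffAt hτ)
    (abs_payoffAt_le hg hG) (fun n => abs_pow_mul_setIntegral_le (M := M) (τ := τ) hK s n
      (measurableSet_le_of_isStoppingTime hτ n)) fun n => ?_).trans ?_
  · rw [setOf_coe_succ_le, integral_payoffAt_add hτ hW hK, setIntegral_le_stoppingTime hτ hW hK,
      setIntegral_congr_fun
        (M.measurableSet_of_filtration (measurableSet_lt_of_isStoppingTime hτ n)) (hlt n),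
      setIntegral_congr_fun (M.measurableSet_of_filtration (hτ.measurableSet_eq n)) (heq n)]
  · simp [M.integral_start s hW]

/-- The first time at which stopping is optimal attains the solution of the Bellman equation. -/
theorem stoppingValue_hittingAfter {W : S → ℝ} (hW : Measurable W) {K : ℝ} (hK : ∀ s, |W s| ≤ K)
    (hfix : p.bellman W = W) (s : S) :
    IsStoppingTime M.filtration (hittingAfter M.X {s | W s ≤ p.G s} 0) ∧
      p.stoppingValue M (hittingAfter M.X {s | W s ≤ p.G s} 0) s = W s := by
  have hτ : IsStoppingTime M.filtration (hittingAfter M.X {s | W s ≤ p.G s} 0) :=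
    M.adapted.isStoppingTime_hittingAfter (measurableSet_le hW p.measurable_G)
  refine ⟨hτ, stoppingValue_eq hτ hW hK (fun n ω h => ?_) (fun n ω h => ?_) s⟩
  · have hn : p.G (M.X n ω) < W (M.X n ω) :=
      not_le.1 fun hle => notMem_of_lt_hittingAfter h n.zero_le hle
    have := congrFun hfix (M.X n ω)
    -- If the maximum were `G`, the Bellman equation would give `W = G`, against `hn`.
    rcases max_choice (p.G (M.X n ω)) (p.continuationValue W (M.X n ω)) with h' | h' <;>
      · rw [bellman, h'] at this
        linarith
  · have hmem := hittingAfter_mem_set_of_ne_top (h.trans_ne WithTop.coe_ne_top)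
    rw [h] at hmem
    exact le_antisymm ((le_max_left _ _).trans_eq (congrFun hfix _)) hmem

/-- Identifies the supremum V* with `W`, and thereby gives its measurability, which is not evident
from a supremum over all stopping times. -/
theorem isGreatest_stoppingValues {W : S → ℝ} (hW : Measurable W) {K : ℝ} (hK : ∀ s, |W s| ≤ K)
    (hfix : p.bellman W = W) (s : S) : IsGreatest (p.stoppingValues M s) (W s) := by
  obtain ⟨hτ, hv⟩ := stoppingValue_hittingAfter (M := M) hW hK hfix s
  refine ⟨⟨_, hτ, hv.symm⟩, ?_⟩
  rintro _ ⟨τ, hτ, rfl⟩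
  exact stoppingValue_le hτ hW hK hfix s

end StoppingProblem

/-! ### One-time marginals of a homogeneous chain -/

section Trajectory

variable {E : Type*} [MeasurableSpace E] {μ₀ : Measure E}

theorem comap_measure_comp {α β δ : Type*} [MeasurableSpace α] [MeasurableSpace β]
    [MeasurableSpace δ] (κ : Kernel β δ) {f : α → β} (hf : Measurable f) (μ : Measure α) :
    κ.comap f hf ∘ₘ μ = κ ∘ₘ μ.map f := by
  ext B hB
  rw [Measure.bind_apply hB (Kernel.measurable _).aemeasurable,
    Measure.bind_apply hB κ.measurable.aemeasurable, lintegral_map (κ.measurable_coe hB) hf]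
  rfl

/-- The marginals of a time-homogeneous Markov chain evolve by its transition kernel. -/
theorem map_eval_succ_trajMeasure [IsProbabilityMeasure μ₀] (κ : Kernel E E) [IsMarkovKernel κ]
    (n : ℕ) :
    (Kernel.trajMeasure (X := fun _ => E) μ₀ fun n =>
        κ.comap (fun h => h ⟨n, Finset.mem_Iic.2 le_rfl⟩) (measurable_pi_apply _)).map
          (fun z => z (n + 1)) =
      κ ∘ₘ (Kernel.trajMeasure (X := fun _ => E) μ₀ fun n =>
        κ.comap (fun h => h ⟨n, Finset.mem_Iic.2 le_rfl⟩) (measurable_pi_apply _)).map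
          (fun z => z n) := by
  set η : (n : ℕ) → Kernel (Finset.Iic n → E) E := fun n =>
    κ.comap (fun h => h ⟨n, Finset.mem_Iic.2 le_rfl⟩) (measurable_pi_apply _)
  -- The joint law of the history and the next state is known; its second marginal is the claim,
  -- because the kernel reads only the last coordinate.
  have h := congrArg Measure.snd
    (Kernel.map_frestrictLe_trajMeasure_compProd_eq_map_trajMeasure (X := fun _ => E) (μ₀ := μ₀)
      (κ := η) (a := n))
  rw [Measure.snd_compProd, Measure.snd, Measure.map_map (by fun_prop) (by fun_prop),
    comap_measure_comp, Measure.map_map (by fun_prop) (by fun_prop)] at h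
  exact h.symm

theorem map_eval_zero_trajMeasure
    (η : (n : ℕ) → Kernel (Finset.Iic n → E) E) [∀ n, IsMarkovKernel (η n)] :
    (Kernel.trajMeasure (X := fun _ => E) μ₀ η).map (fun z => z 0) = μ₀ := by
  have h : (fun z : ℕ → E => z 0) =
      (fun h : Finset.Iic 0 → E => h ⟨0, Finset.mem_Iic.2 le_rfl⟩) ∘ Preorder.frestrictLe 0 := rfl
  rw [h, ← Measure.map_map (by fun_prop) (by fun_prop), Kernel.trajMeasure,
    Measure.map_comp _ _ (by fun_prop), Kernel.traj_map_frestrictLe, Kernel.partialTraj_self,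
    Measure.id_comp, Measure.map_map (by fun_prop) (by fun_prop)]
  exact Measure.map_id

end Trajectory

/-! ### Verification for policies -/

namespace StoppingProblem

variable {S : Type*} [MeasurableSpace S] (p : StoppingProblem S) (π : StationaryPolicy S)

/-- The new action depends on the past only through the new state, so the previous pair can be
integrated out first. -/
theorem stepKernel_comp (ρ : Measure ((S ⊕ Unit) × Fin 2)) [IsFiniteMeasure ρ] :
    p.stepKernel π ∘ₘ ρ = (p.transition ∘ₘ ρ) ⊗ₘ π.toKernel := by
  ext B hB
  have hm := Kernel.measurable_kernel_prodMk_left (κ := π.toKernel) hB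
  rw [Measure.bind_apply hB (Kernel.measurable _).aemeasurable, Measure.compProd_apply hB,
    Measure.lintegral_bind p.transition.measurable.aemeasurable hm.aemeasurable]
  refine lintegral_congr fun z => ?_
  rw [stepKernel, Kernel.compProd_apply hB]
  rfl

variable (x : S ⊕ Unit)

/-- The law of the state-action pair at time `n` under the policy `π`, started from `x`. -/
noncomputable def marginal (n : ℕ) : Measure ((S ⊕ Unit) × Fin 2) :=
  (p.processLaw π (Measure.dirac x)).map fun z => z n

instance : IsProbabilityMeasure (p.processLaw π (Measure.dirac x)) := by
  unfold processLaw
  infer_instance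

instance (n : ℕ) : IsProbabilityMeasure (p.marginal π x n) :=
  Measure.isProbabilityMeasure_map (measurable_pi_apply n).aemeasurable

theorem marginal_zero : p.marginal π x 0 = Measure.dirac x ⊗ₘ π.toKernel :=
  map_eval_zero_trajMeasure _

theorem marginal_succ (n : ℕ) :
    p.marginal π x (n + 1) = (p.transition ∘ₘ p.marginal π x n) ⊗ₘ π.toKernel := by
  rw [← stepKernel_comp]
  exact map_eval_succ_trajMeasure _ n

theorem fst_marginal_succ (n : ℕ) :
    (p.marginal π x (n + 1)).fst = p.transition ∘ₘ p.marginal π x n := by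
  rw [marginal_succ, Measure.fst_compProd]

/-- At every time the action is drawn from `π` given the current state, so the telescoping can be
run on the state marginals alone. -/
theorem marginal_eq_compProd (n : ℕ) :
    p.marginal π x n = (p.marginal π x n).fst ⊗ₘ π.toKernel := by
  cases n with
  | zero => rw [marginal_zero, Measure.fst_compProd]
  | succ n => rw [fst_marginal_succ, marginal_succ]

theorem measurable_reward : Measurable fun z : (S ⊕ Unit) × Fin 2 => p.reward z.1 z.2 := by
  have hg : Measurable p.gΔ := measurable_fun_sum p.measurable_g measurable_const
  have hG : Measurable p.GΔ := measurable_fun_sum p.measurable_G measurable_const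
  have ha : Measurable fun z : (S ⊕ Unit) × Fin 2 => ((z.2 : ℕ) : ℝ) :=
    (measurable_of_finite fun a : Fin 2 => ((a : ℕ) : ℝ)).comp measurable_snd
  exact ((hg.comp measurable_fst).mul ha).add
    ((hG.comp measurable_fst).mul (measurable_const.sub ha))

theorem exists_abs_reward_le : ∃ C, ∀ z : (S ⊕ Unit) × Fin 2, |p.reward z.1 z.2| ≤ C := by
  obtain ⟨C, hg, hG⟩ := p.exists_bound
  -- The cemetery reward 0 needs a nonnegative bound, even when `S` is empty.
  refine ⟨max C 0, ?_⟩
  rintro ⟨s | u, a⟩ <;> fin_cases a <;> simp [reward, gΔ, GΔ, hg, hG]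

/-- The reward of taking action `a` in state `x` and then collecting `f` at the next state. -/
noncomputable def actionValue (f : S ⊕ Unit → ℝ) (z : (S ⊕ Unit) × Fin 2) : ℝ :=
  p.reward z.1 z.2 + p.γ * ∫ y, f y ∂p.transition z

variable {f : S ⊕ Unit → ℝ} {K : ℝ}

theorem measurable_actionValue (hf : Measurable f) : Measurable (p.actionValue f) :=
  p.measurable_reward.add ((measurable_integral_kernel p.transition hf).const_mul _)

theorem exists_abs_actionValue_le (hK : ∀ x, |f x| ≤ K) : ∃ C, ∀ z, |p.actionValue f z| ≤ C := by
  obtain ⟨C, hC⟩ := p.exists_abs_reward_le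
  exact ⟨C + p.γ * K, fun z =>
    (abs_add_le _ _).trans (add_le_add (hC z) (p.abs_mul_integral_le hK))⟩

/-- The counterpart of `integral_payoffAt_add`: reward and discounted next value merge into the
action value, averaged over the policy. -/
theorem integral_reward_add (hf : Measurable f) (hK : ∀ x, |f x| ≤ K) (n : ℕ) :
    ∫ z, p.γ ^ n * p.reward (z n).1 (z n).2 ∂p.processLaw π (Measure.dirac x)
        + p.γ ^ (n + 1) * ∫ y, f y ∂(p.marginal π x (n + 1)).fst =
      p.γ ^ n * ∫ y, ∫ a, p.actionValue f (y, a) ∂π.toKernel y ∂(p.marginal π x n).fst := by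
  obtain ⟨C, hC⟩ := p.exists_abs_reward_le
  obtain ⟨D, hD⟩ := p.exists_abs_actionValue_le hK
  have hr : ∫ z, p.reward (z n).1 (z n).2 ∂p.processLaw π (Measure.dirac x) =
      ∫ z, p.reward z.1 z.2 ∂p.marginal π x n := by
    rw [marginal, integral_map (measurable_pi_apply n).aemeasurable
      p.measurable_reward.aestronglyMeasurable]
  rw [integral_const_mul, hr, fst_marginal_succ, integral_measure_comp hf hK,
    ← Measure.integral_compProd
      (integrable_of_measurable_of_abs_le (p.measurable_actionValue hf) hD),
    ← marginal_eq_compProd]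
  simp only [actionValue]
  rw [integral_add (integrable_of_measurable_of_abs_le p.measurable_reward hC)
    (integrable_of_measurable_of_abs_le ((measurable_integral_kernel p.transition hf).const_mul _)
      fun z => p.abs_mul_integral_le hK), integral_const_mul]
  ring

theorem integral_fst_marginal_zero (hf : Measurable f) :
    ∫ y, f y ∂(p.marginal π x 0).fst = f x := by
  rw [marginal_zero, Measure.fst_compProd, integral_dirac' _ _ hf.stronglyMeasurable]

theorem abs_pow_mul_integral_le {α : Type*} [MeasurableSpace α] {μ : Measure α}
    [IsProbabilityMeasure μ] {h : α → ℝ} (hK : ∀ x, |h x| ≤ K) (n : ℕ) :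
    |p.γ ^ n * ∫ y, h y ∂μ| ≤ p.γ ^ n * K := by
  rw [abs_mul, abs_of_pos (pow_pos p.γ_pos n)]
  exact mul_le_mul_of_nonneg_left (abs_integral_le_of_abs_le hK) (pow_nonneg p.γ_pos.le n)

theorem measurable_discounted_reward (n : ℕ) :
    Measurable fun z : ℕ → (S ⊕ Unit) × Fin 2 => p.γ ^ n * p.reward (z n).1 (z n).2 :=
  (p.measurable_reward.comp (measurable_pi_apply n)).const_mul _

theorem abs_discounted_reward_le {C : ℝ}
    (hC : ∀ z : (S ⊕ Unit) × Fin 2, |p.reward z.1 z.2| ≤ C) (n : ℕ)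
    (z : ℕ → (S ⊕ Unit) × Fin 2) : |p.γ ^ n * p.reward (z n).1 (z n).2| ≤ p.γ ^ n * C := by
  rw [abs_mul, abs_of_pos (pow_pos p.γ_pos n)]
  exact mul_le_mul_of_nonneg_left (hC _) (pow_nonneg p.γ_pos.le n)

/-- A function that dominates the value of every action dominates the value of every policy. -/
theorem policyValue_le (hf : Measurable f) (hK : ∀ x, |f x| ≤ K)
    (h : ∀ z, p.actionValue f z ≤ f z.1) : p.policyValue π x ≤ f x := by
  obtain ⟨C, hC⟩ := p.exists_abs_reward_le
  obtain ⟨D, hD⟩ := p.exists_abs_actionValue_le hK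
  refine (integral_tsum_le_of_add_le p.γ_pos p.γ_lt_one p.measurable_discounted_reward
    (p.abs_discounted_reward_le hC)
    (a := fun n => p.γ ^ n * ∫ y, f y ∂(p.marginal π x n).fst)
    (fun n => p.abs_pow_mul_integral_le hK n) fun n => ?_).trans_eq ?_
  · rw [p.integral_reward_add π x hf hK]
    refine mul_le_mul_of_nonneg_left ?_ (pow_nonneg p.γ_pos.le n)
    refine integral_mono (integrable_of_measurable_of_abs_le ?_ fun y =>
      abs_integral_le_of_abs_le fun a => hD (y, a)) (integrable_of_measurable_of_abs_le hf hK)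
      fun y => ?_
    · exact ((p.measurable_actionValue hf).stronglyMeasurable.integral_kernel_prod_right'
        (κ := π.toKernel)).measurable
    · refine (integral_mono (integrable_of_measurable_of_abs_le
        ((p.measurable_actionValue hf).comp measurable_prodMk_left) fun a => hD (y, a))
        (integrable_const (f y)) fun a => h (y, a)).trans_eq ?_
      simp
  · simp [p.integral_fst_marginal_zero π x hf]

/-- A policy under which `f` is reproduced in expectation at each step has value `f`. -/
theorem policyValue_eq (hf : Measurable f) (hK : ∀ x, |f x| ≤ K)
    (h : ∀ y, ∫ a, p.actionValue f (y, a) ∂π.toKernel y = f y) : p.policyValue π x = f x := by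
  obtain ⟨C, hC⟩ := p.exists_abs_reward_le
  refine (integral_tsum_eq_of_add_eq p.γ_pos p.γ_lt_one p.measurable_discounted_reward
    (p.abs_discounted_reward_le hC)
    (a := fun n => p.γ ^ n * ∫ y, f y ∂(p.marginal π x n).fst)
    (fun n => p.abs_pow_mul_integral_le hK n) fun n => ?_).trans ?_
  · rw [p.integral_reward_add π x hf hK]
    simp only [h]
  · simp [p.integral_fst_marginal_zero π x hf]

/-! ### The Bellman solution as value of the stopped MDP -/

variable {W : S → ℝ}

theorem actionValue_continuing (hW : Measurable W) (s : S) :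
    p.actionValue (Sum.elim W fun _ => 0) (Sum.inl s, 1) = p.continuationValue W s := by
  have ht : p.transition (Sum.inl s, 1) = (p.P s).map Sum.inl := rfl
  have hm : Measurable (Sum.elim W fun _ : Unit => (0 : ℝ)) :=
    measurable_fun_sum hW measurable_const
  simp [actionValue, ht, integral_map measurable_inl.aemeasurable hm.aestronglyMeasurable, reward,
    gΔ, continuationValue]

theorem actionValue_stopping (hW : Measurable W) (s : S) :
    p.actionValue (Sum.elim W fun _ => 0) (Sum.inl s, 0) = p.G s := by
  have ht : p.transition (Sum.inl s, 0) = Measure.dirac (Sum.inr ()) := rfl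
  have hm : Measurable (Sum.elim W fun _ : Unit => (0 : ℝ)) :=
    measurable_fun_sum hW measurable_const
  simp [actionValue, ht, integral_dirac' _ _ hm.stronglyMeasurable, reward, GΔ]

theorem actionValue_cemetery (hW : Measurable W) (u : Unit) (a : Fin 2) :
    p.actionValue (Sum.elim W fun _ => 0) (Sum.inr u, a) = 0 := by
  have ht : p.transition (Sum.inr u, a) = Measure.dirac (Sum.inr ()) := rfl
  have hm : Measurable (Sum.elim W fun _ : Unit => (0 : ℝ)) :=
    measurable_fun_sum hW measurable_const
  simp [actionValue, ht, integral_dirac' _ _ hm.stronglyMeasurable, reward, gΔ, GΔ]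

/-- On `S` the two action values are the two branches of the Bellman maximum; at the cemetery both
sides vanish. -/
theorem actionValue_le (hW : Measurable W) (hfix : p.bellman W = W) (z : (S ⊕ Unit) × Fin 2) :
    p.actionValue (Sum.elim W fun _ => 0) z ≤ Sum.elim W (fun _ => 0) z.1 := by
  rcases z with ⟨s | u, a⟩
  · fin_cases a
    · exact (p.actionValue_stopping hW s).trans_le ((le_max_left _ _).trans_eq (congrFun hfix s))
    · exact (p.actionValue_continuing hW s).trans_le ((le_max_right _ _).trans_eq (congrFun hfix s))
  · exact (p.actionValue_cemetery hW u a).le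

end StoppingProblem

open Classical in
/-- The deterministic policy that stops on the set `D` and continues elsewhere. -/
noncomputable def StationaryPolicy.stopOn {S : Type*} [MeasurableSpace S] {D : Set S}
    (hD : MeasurableSet D) : StationaryPolicy S where
  toKernel := Kernel.deterministic
    (Sum.elim (fun s => if s ∈ D then (0 : Fin 2) else 1) fun _ => 0)
    (measurable_fun_sum (Measurable.ite hD measurable_const measurable_const) measurable_const)
  isMarkovKernel := inferInstance
  cemetery := by simp [Kernel.deterministic_apply]

namespace StationaryPolicy

variable {S : Type*} [MeasurableSpace S] {D : Set S} (hD : MeasurableSet D) {s : S}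

theorem stopOn_of_mem (hs : s ∈ D) : (stopOn hD).toKernel (Sum.inl s) = Measure.dirac 0 := by
  simp [stopOn, Kernel.deterministic_apply, hs]

theorem stopOn_of_notMem (hs : s ∉ D) : (stopOn hD).toKernel (Sum.inl s) = Measure.dirac 1 := by
  simp [stopOn, Kernel.deterministic_apply, hs]

end StationaryPolicy

/-- Stopping exactly where the stopping gain attains the solution of the Bellman equation is an
optimal policy. -/
theorem StoppingProblem.policyValue_stopOn {S : Type*} [MeasurableSpace S] (p : StoppingProblem S)
    {W : S → ℝ} (hW : Measurable W) {K : ℝ} (hK : ∀ s, |W s| ≤ K) (hfix : p.bellman W = W)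
    (hD : MeasurableSet {s | W s ≤ p.G s}) (x : S ⊕ Unit) :
    p.policyValue (StationaryPolicy.stopOn hD) x = Sum.elim W (fun _ => 0) x ∧
      IsGreatest (Set.range fun π : StationaryPolicy S => p.policyValue π x)
        (p.policyValue (StationaryPolicy.stopOn hD) x) := by
  have hf : Measurable (Sum.elim W fun _ : Unit => (0 : ℝ)) :=
    measurable_fun_sum hW measurable_const
  have hfK (x : S ⊕ Unit) : |Sum.elim W (fun _ => (0 : ℝ)) x| ≤ max K 0 := by
    rcases x with s | u
    · exact (hK s).trans (le_max_left _ _)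
    · simp
  have hv : p.policyValue (StationaryPolicy.stopOn hD) x = Sum.elim W (fun _ => 0) x := by
    refine p.policyValue_eq _ x hf hfK ?_
    rintro (s | u)
    · by_cases hs : s ∈ {s | W s ≤ p.G s}
      · rw [StationaryPolicy.stopOn_of_mem hD hs, integral_dirac, p.actionValue_stopping hW]
        exact le_antisymm ((le_max_left _ _).trans_eq (congrFun hfix s)) hs
      · rw [StationaryPolicy.stopOn_of_notMem hD hs, integral_dirac, p.actionValue_continuing hW]
        have := congrFun hfix s
        rcases max_choice (p.G s) (p.continuationValue W s) with h | h
        · exact absurd (this.symm.trans h).le hs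
        · exact h.symm.trans this
    · simp [p.actionValue_cemetery hW]
  refine ⟨hv, ⟨_, rfl⟩, ?_⟩
  rintro _ ⟨π, rfl⟩
  rw [hv]
  exact p.policyValue_le π x hf hfK (p.actionValue_le hW hfix)

theorem proposition1 {S : Type*} [MeasurableSpace S] (p : StoppingProblem S)
    {Ω : Type*} [MeasurableSpace Ω] (M : MarkovFamily p.P Ω) :
    -- the hitting time of the stopping region is an optimal stopping time
    IsStoppingTime M.filtration (p.hittingTime M) ∧
    (∀ s : S, IsGreatest (p.stoppingValues M s) (p.stoppingValue M (p.hittingTime M) s)) ∧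
    -- the deterministic policy that continues on the continuation region and stops elsewhere
    ∃ πstar : StationaryPolicy S,
      (∀ s ∈ p.continuationRegion M, πstar.toKernel (Sum.inl s) = Measure.dirac 1) ∧
      (∀ s ∈ p.stoppingRegion M, πstar.toKernel (Sum.inl s) = Measure.dirac 0) ∧
      -- is an optimal policy
      (∀ x : S ⊕ Unit, IsGreatest (Set.range fun π : StationaryPolicy S => p.policyValue π x)
        (p.policyValue πstar x)) ∧
      -- and the two optimal values agree
      ∀ s : S, p.stoppingValue M (p.hittingTime M) s = p.policyValue πstar (Sum.inl s) := by

  obtain ⟨W, hW, ⟨K, hK⟩, hfix⟩ := p.exists_bellman_eq_self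
  -- Since `W` depends only on `p`, this frees V* and D* from the chosen realization `M` and lets
  -- both problems be compared through `W`.
  have hV (s : S) : p.optimalStoppingValue M s = W s :=
    (StoppingProblem.isGreatest_stoppingValues hW hK hfix s).csSup_eq
  have hD : p.stoppingRegion M = {s | W s ≤ p.G s} := by
    simp only [StoppingProblem.stoppingRegion, hV]
  have hDm : MeasurableSet {s | W s ≤ p.G s} := measurableSet_le hW p.measurable_G
  have hτ : IsStoppingTime M.filtration (p.hittingTime M) := by
    rw [StoppingProblem.hittingTime, hD]
    exact M.adapted.isStoppingTime_hittingAfter hDm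
  have hval (s : S) : p.stoppingValue M (p.hittingTime M) s = W s := by
    rw [StoppingProblem.hittingTime, hD]
    exact (StoppingProblem.stoppingValue_hittingAfter hW hK hfix s).2
  refine ⟨hτ, fun s => ?_, StationaryPolicy.stopOn hDm, fun s hs => ?_, fun s hs => ?_,
    fun x => (p.policyValue_stopOn hW hK hfix hDm x).2, fun s => ?_⟩
  · rw [hval]
    exact StoppingProblem.isGreatest_stoppingValues hW hK hfix s
  · refine StationaryPolicy.stopOn_of_notMem hDm ?_
    simpa only [StoppingProblem.continuationRegion, hV, Set.mem_ofPred_eq, not_le] using hs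
  · exact StationaryPolicy.stopOn_of_mem hDm (hD ▸ hs)
  · rw [hval, (p.policyValue_stopOn hW hK hfix hDm _).1]
    rfl
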